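/- Let $p\ge 1$, $0<\alpha_1<1$, $\alpha_2:=1-\alpha_1$, let $\mu_1\ne\mu_2$ be vectors in $\mathbb{R}^p$ and let $\Sigma\in\mathbb{R}^{p\times p}$ be symmetric positive definite. Let $(x_1,y_1),(x_2,y_2),\dots$ be independent copies of a pair $(x,y)$ with values in $\mathbb{R}^p\times\{0,1\}$ such that $$y\sim\mathrm{Ber}(\alpha_1),\qquad x\mid y\sim\mathcal N_p\{y\mu_1+(1-y)\mu_2,\ \Sigma\}.$$ Put $$\bar x_{n1}:=\frac{\sum_{i=1}^n y_i x_i}{\sum_{i=1}^n y_i},\qquad \bar x_{n2}:=\frac{\sum_{i=1}^n(1-y_i)x_i}{\sum_{i=1}^n(1-y_i)},$$ $$S_n:=\frac1{n-2}\Big\{\sum_{i=1}^n y_i(x_i-\bar x_{n1})(x_i-\bar x_{n1})'+\sum_{i=1}^n(1-y_i)(x_i-\bar x_{n2})(x_i-\bar x_{n2})'\Big\},$$ $w_n:=S_n^{-1}(\bar x_{n2}-\bar x_{n1})$ and $\theta:=\Sigma^{-1}(\mu_2-\mu_1)$. (Reciprocals of $0$ and inverses of singular matrices are taken to be $0$;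 the event where this convention is needed has probability tending to $0$ as $n\to\infty$.) Then, as $n\to\infty$, $$\sqrt n\left(\frac{w_n}{\|w_n\|}-\frac{\theta}{\|\theta\|}\right)\rightsquigarrow\mathcal N_p(0,\Psi_U),\qquad \Psi_U:=\frac{1+\beta\tau}{\|\theta\|^2\beta}\Big(I_p-\frac{\theta\theta'}{\|\theta\|^2}\Big)\Sigma^{-1}\Big(I_p-\frac{\theta\theta'}{\|\theta\|^2}\Big),$$ where $\beta:=\alpha_1\alpha_2$, $\tau:=(\mu_2-\mu_1)'\Sigma^{-1}(\mu_2-\mu_1)$, $\|\cdot\|$ is the Euclidean norm and $\rightsquigarrow$ denotes convergence in distribution. -/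

import Mathlib

open MeasureTheory ProbabilityTheory Filter Matrix

namespace LDA

noncomputable section

open scoped MatrixOrder

/-- The conditional law of `x` given `y`: the Gaussian `N_p(y μ₁ + (1 - y) μ₂, S)`,
as a Markov kernel in the label `y`. -/
def classKernel {p : ℕ} (μ₁ μ₂ : EuclideanSpace ℝ (Fin p)) (S : Matrix (Fin p) (Fin p) ℝ) :
    Kernel ℝ (EuclideanSpace ℝ (Fin p)) where
  toFun y := multivariateGaussian (y • μ₁ + (1 - y) • μ₂) S
  measurable' := by
    refine Measure.measurable_of_measurable_coe _ fun s hs ↦ ?_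
    have h (y : ℝ) : multivariateGaussian (y • μ₁ + (1 - y) • μ₂) S s =
        stdGaussian (EuclideanSpace ℝ (Fin p))
          (Prod.mk y ⁻¹' {q : ℝ × EuclideanSpace ℝ (Fin p) | (q.1 • μ₁ + (1 - q.1) • μ₂) +
            toEuclideanCLM (𝕜 := ℝ) (CFC.sqrt S) q.2 ∈ s}) := by
      rw [multivariateGaussian, Measure.map_apply (by fun_prop) hs]
      rfl
    simp_rw [h]
    refine measurable_measure_prodMk_left (ν := stdGaussian (EuclideanSpace ℝ (Fin p)))
      (s := {q : ℝ × EuclideanSpace ℝ (Fin p) | (q.1 • μ₁ + (1 - q.1) • μ₂) +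
        toEuclideanCLM (𝕜 := ℝ) (CFC.sqrt S) q.2 ∈ s}) ?_
    exact (by fun_prop : Measurable fun q : ℝ × EuclideanSpace ℝ (Fin p) ↦
      (q.1 • μ₁ + (1 - q.1) • μ₂) + toEuclideanCLM (𝕜 := ℝ) (CFC.sqrt S) q.2) hs

instance {p : ℕ} (μ₁ μ₂ : EuclideanSpace ℝ (Fin p)) (S : Matrix (Fin p) (Fin p) ℝ) :
    IsMarkovKernel (classKernel μ₁ μ₂ S) where
  isProbabilityMeasure y :=
    inferInstanceAs (IsProbabilityMeasure (multivariateGaussian (y • μ₁ + (1 - y) • μ₂) S))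

/-- `(X i, Y i)`, `i = 0, 1, 2, …`, is an i.i.d. sequence of copies of the pair `(x, y)` with
`y ∼ Ber(α₁)` and `x ∣ y ∼ N_p(y μ₁ + (1 - y) μ₂, S)`. The label `1` has probability `α₁`. -/
structure IsSample {Ω : Type*} [MeasurableSpace Ω] (P : Measure Ω) {p : ℕ} (α₁ : unitInterval)
    (μ₁ μ₂ : EuclideanSpace ℝ (Fin p)) (S : Matrix (Fin p) (Fin p) ℝ)
    (X : ℕ → Ω → EuclideanSpace ℝ (Fin p)) (Y : ℕ → Ω → ℝ) : Prop where
  indep : iIndepFun (fun i ω ↦ (X i ω, Y i ω)) P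
  label : ∀ i, HasLaw (Y i) (bernoulliMeasure (1 : ℝ) 0 α₁) P
  cond : ∀ i, HasCondDistrib (X i) (Y i) (classKernel μ₁ μ₂ S) P

variable {p : ℕ}

/-- The matrix-vector product `A v`. -/
def mulVecE (A : Matrix (Fin p) (Fin p) ℝ) (v : EuclideanSpace ℝ (Fin p)) :
    EuclideanSpace ℝ (Fin p) :=
  WithLp.toLp 2 (A *ᵥ v.ofLp)

/-- The rank-one matrix `v v'`. -/
def outer (v : EuclideanSpace ℝ (Fin p)) : Matrix (Fin p) (Fin p) ℝ :=
  vecMulVec v.ofLp v.ofLp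

/-- Weighted mean of the first `n` observations; with the weights `y` this is the mean of the
first group, with the weights `1 - y` that of the second. -/
def weightedMean (n : ℕ) (x : ℕ → EuclideanSpace ℝ (Fin p)) (w : ℕ → ℝ) :
    EuclideanSpace ℝ (Fin p) :=
  (∑ i ∈ Finset.range n, w i)⁻¹ • ∑ i ∈ Finset.range n, w i • x i

/-- The mean of the observations with label `1`. -/
def mean₁ (n : ℕ) (x : ℕ → EuclideanSpace ℝ (Fin p)) (y : ℕ → ℝ) : EuclideanSpace ℝ (Fin p) :=
  weightedMean n x y

/-- The mean of the observations with label `0`. -/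
def mean₂ (n : ℕ) (x : ℕ → EuclideanSpace ℝ (Fin p)) (y : ℕ → ℝ) : EuclideanSpace ℝ (Fin p) :=
  weightedMean n x (fun i ↦ 1 - y i)

/-- The pooled within-group sample covariance matrix `S_n`. -/
def pooledCov (n : ℕ) (x : ℕ → EuclideanSpace ℝ (Fin p)) (y : ℕ → ℝ) :
    Matrix (Fin p) (Fin p) ℝ :=
  ((n : ℝ) - 2)⁻¹ • (∑ i ∈ Finset.range n, y i • outer (x i - mean₁ n x y) +
    ∑ i ∈ Finset.range n, (1 - y i) • outer (x i - mean₂ n x y))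

/-- The unit vector `v / ‖v‖` (and `0` if `v = 0`). -/
def unit (v : EuclideanSpace ℝ (Fin p)) : EuclideanSpace ℝ (Fin p) :=
  ‖v‖⁻¹ • v

/-- The LDA estimator `w_n = S_n⁻¹ (x̄_{n2} - x̄_{n1})`. -/
def ldaEstimator (n : ℕ) (x : ℕ → EuclideanSpace ℝ (Fin p)) (y : ℕ → ℝ) :
    EuclideanSpace ℝ (Fin p) :=
  mulVecE (pooledCov n x y)⁻¹ (mean₂ n x y - mean₁ n x y)

/-- The discriminant direction `θ = S⁻¹ (μ₂ - μ₁)`. -/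
def discriminant (μ₁ μ₂ : EuclideanSpace ℝ (Fin p)) (S : Matrix (Fin p) (Fin p) ℝ) :
    EuclideanSpace ℝ (Fin p) :=
  mulVecE S⁻¹ (μ₂ - μ₁)

/-- The squared Mahalanobis distance `τ = (μ₂ - μ₁)' S⁻¹ (μ₂ - μ₁)`. -/
def mahalanobisSq (μ₁ μ₂ : EuclideanSpace ℝ (Fin p)) (S : Matrix (Fin p) (Fin p) ℝ) : ℝ :=
  (μ₂ - μ₁).ofLp ⬝ᵥ (S⁻¹ *ᵥ (μ₂ - μ₁).ofLp)

/-- The matrix `I - v v' / ‖v‖²`. -/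
def projCompl (v : EuclideanSpace ℝ (Fin p)) : Matrix (Fin p) (Fin p) ℝ :=
  1 - (‖v‖ ^ 2)⁻¹ • outer v

/-- The limiting covariance matrix
`Ψ_U = (1 + β τ) / (‖θ‖² β) (I - θ θ' / ‖θ‖²) S⁻¹ (I - θ θ' / ‖θ‖²)`, `β = α₁ (1 - α₁)`. -/
def limitCov (α₁ : ℝ) (μ₁ μ₂ : EuclideanSpace ℝ (Fin p)) (S : Matrix (Fin p) (Fin p) ℝ) :
    Matrix (Fin p) (Fin p) ℝ :=
  ((1 + α₁ * (1 - α₁) * mahalanobisSq μ₁ μ₂ S) /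
      (‖discriminant μ₁ μ₂ S‖ ^ 2 * (α₁ * (1 - α₁)))) •
    (projCompl (discriminant μ₁ μ₂ S) * S⁻¹ * projCompl (discriminant μ₁ μ₂ S))

end

end LDA

/-
The unit vector `w_n / ‖w_n‖` is a smooth function of the averages of the i.i.d. vectors
`(y, y x, 1 - y, (1 - y) x, x x')`, because the factor `n - 2` in `S_n` cancels on normalizing. Its
limit law is therefore given by the delta method. Up to the factor `S⁻¹`, the derivative at the
population moments sends the moments of an observation `x` from the first group to
`-(1 / α₁ + ⟨θ, z⟩) z` with `z = x - μ₁`, and from the second group to `(1 / α₂ - ⟨θ, z⟩) z` with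
`z = x - μ₂`. Normalizing restricts attention to functionals `s` with `⟨s, θ⟩ = 0`. For these
`⟨S⁻¹ s, z⟩` and `⟨θ, z⟩` are uncorrelated, hence independent, Gaussian variables, so only their
second moments enter the limiting covariance.
-/

open scoped Topology RealInnerProductSpace
open InnerProductSpace

namespace LDA

section CentralLimit

variable {Ω ι : Type*} [MeasurableSpace Ω] {P : Measure Ω} [Fintype ι]

/-- The covariance matrix of a random vector, the parameter of its Gaussian limit in the central
limit theorem. -/
noncomputable def covMat (P : Measure Ω) (ξ : Ω → EuclideanSpace ℝ ι) : Matrix ι ι ℝ :=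
  Matrix.of fun i j ↦ cov[fun ω ↦ ξ ω i, fun ω ↦ ξ ω j; P]

lemma dotProduct_covMat_mulVec [IsFiniteMeasure P] {ξ : Ω → EuclideanSpace ℝ ι} (hξ : MemLp ξ 2 P)
    (t : EuclideanSpace ℝ ι) :
    t.ofLp ⬝ᵥ covMat P ξ *ᵥ t.ofLp = Var[fun ω ↦ ⟪t, ξ ω⟫; P] := by
  have hcoord (i : ι) : MemLp (fun ω ↦ t i * ξ ω i) 2 P :=
    ((EuclideanSpace.proj (𝕜 := ℝ) i).comp_memLp' hξ).const_mul _
  have hinner (ω : Ω) : ⟪t, ξ ω⟫ = ∑ i, t i * ξ ω i := by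
    simp [PiLp.inner_apply, mul_comm]
  simp_rw [hinner]
  rw [variance_fun_sum hcoord]
  simp_rw [dotProduct, mulVec, dotProduct, covMat, Matrix.of_apply, Finset.mul_sum,
    covariance_const_mul_left, covariance_const_mul_right]
  exact Finset.sum_congr rfl fun i _ ↦ Finset.sum_congr rfl fun j _ ↦ by ring

lemma posSemidef_covMat [IsFiniteMeasure P] {ξ : Ω → EuclideanSpace ℝ ι} (hξ : MemLp ξ 2 P) :
    (covMat P ξ).PosSemidef := by
  refine Matrix.PosSemidef.of_dotProduct_mulVec_nonneg ?_ fun x ↦ ?_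
  · ext i j
    simp [covMat, covariance_comm]
  · rw [star_trivial, ← WithLp.ofLp_toLp 2 x, dotProduct_covMat_mulVec hξ]
    exact variance_nonneg _ _

variable [DecidableEq ι]

lemma charFun_multivariateGaussian_covMat [IsFiniteMeasure P]
    {ξ : Ω → EuclideanSpace ℝ ι} (hξ : MemLp ξ 2 P) (t : EuclideanSpace ℝ ι) :
    charFun (multivariateGaussian 0 (covMat P ξ)) t =
      Complex.exp (-(Var[fun ω ↦ ⟪t, ξ ω⟫; P] : ℂ) / 2) := by
  rw [charFun_multivariateGaussian (posSemidef_covMat hξ), dotProduct_covMat_mulVec hξ]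
  simp [neg_div]

lemma map_multivariateGaussian_covMat [IsFiniteMeasure P] {κ : Type*} [Fintype κ] [DecidableEq κ]
    {ξ : Ω → EuclideanSpace ℝ ι} (hξ : MemLp ξ 2 P)
    (A : EuclideanSpace ℝ ι →L[ℝ] EuclideanSpace ℝ κ) {Ψ : Matrix κ κ ℝ} (hΨ : Ψ.PosSemidef)
    (h : ∀ t : EuclideanSpace ℝ κ, Var[fun ω ↦ ⟪t, A (ξ ω)⟫; P] = t.ofLp ⬝ᵥ Ψ *ᵥ t.ofLp) :
    (multivariateGaussian 0 (covMat P ξ)).map A = multivariateGaussian 0 Ψ := by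
  refine Measure.ext_of_charFun (funext fun t ↦ ?_)
  have hmap : charFun ((multivariateGaussian 0 (covMat P ξ)).map A) t =
      charFun (multivariateGaussian 0 (covMat P ξ)) (A.adjoint t) := by
    rw [charFun_apply, charFun_apply, integral_map (by fun_prop) (by fun_prop)]
    simp only [ContinuousLinearMap.adjoint_inner_right]
  rw [hmap, charFun_multivariateGaussian_covMat hξ, charFun_multivariateGaussian hΨ, ← h]
  simp [ContinuousLinearMap.adjoint_inner_left, neg_div]

theorem tendstoInDistribution_inv_sqrt_smul_sum_sub [IsProbabilityMeasure P]
    {ξ : ℕ → Ω → EuclideanSpace ℝ ι}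
    (hξ : MemLp (ξ 0) 2 P) (hindep : iIndepFun ξ P)
    (hident : ∀ i, IdentDistrib (ξ i) (ξ 0) P P) :
    TendstoInDistribution
      (fun (n : ℕ) ω ↦ (√n)⁻¹ • (∑ k ∈ Finset.range n, ξ k ω - (n : ℝ) • P[ξ 0]))
      atTop id (fun _ ↦ P) (multivariateGaussian 0 (covMat P (ξ 0))) where
  forall_aemeasurable n := by
    have := fun i ↦ (hident i).aemeasurable_fst
    fun_prop
  tendsto := by
    refine ProbabilityMeasure.tendsto_iff_tendsto_charFun.2 fun t ↦ ?_
    have hmeas (i : ℕ) : AEMeasurable (ξ i) P := (hident i).aemeasurable_fst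
    have hmean : ∫ ω, ⟪t, ξ 0 ω⟫ ∂P = ⟪t, P[ξ 0]⟫ :=
      integral_inner (hξ.integrable one_le_two) t
    have hclt := tendstoInDistribution_inv_sqrt_mul_sum_sub (P := P)
      (X := fun i ω ↦ ⟪t, ξ i ω⟫) HasLaw.id (hξ.const_inner t)
      (hindep.comp (fun _ x ↦ ⟪t, x⟫) (by fun_prop))
      (fun i ↦ (hident i).comp (u := fun x ↦ ⟪t, x⟫) (by fun_prop))
    have hchar := ProbabilityMeasure.tendsto_iff_tendsto_charFun.1 hclt.tendsto 1
    simp only [ProbabilityMeasure.coe_mk, Measure.map_id] at hchar ⊢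
    rw [charFun_gaussianReal] at hchar
    rw [charFun_multivariateGaussian_covMat hξ]
    simp only [Complex.ofReal_one, Complex.ofReal_zero, mul_zero, zero_mul, one_pow, mul_one,
      zero_sub, Real.coe_toNNReal _ (variance_nonneg _ _), ← neg_div] at hchar
    refine hchar.congr fun n ↦ ?_
    rw [charFun_apply, charFun_apply, integral_map (by fun_prop) (by fun_prop),
      integral_map (by fun_prop) (by fun_prop)]
    refine integral_congr_ae (Eventually.of_forall fun ω ↦ ?_)
    simp [hmean, inner_smul_left, inner_sub_left, sum_inner, real_inner_comm]

end CentralLimit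

section ConvergenceInDistribution

variable {Ω Ω' ι G : Type*} [MeasurableSpace Ω] {P : Measure Ω} [IsProbabilityMeasure P]
  [MeasurableSpace Ω'] {P' : Measure Ω'} [IsProbabilityMeasure P'] {l : Filter ι}

section Topological

variable [TopologicalSpace G] [MeasurableSpace G] [OpensMeasurableSpace G]
  {X X' : ι → Ω → G} {Z : Ω' → G}

lemma tendstoInDistribution_of_eventuallyEq
    (h : TendstoInDistribution X l Z (fun _ ↦ P) P') (hX' : ∀ i, AEMeasurable (X' i) P)
    (hXX' : ∀ᶠ i in l, X i =ᵐ[P] X' i) :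
    TendstoInDistribution X' l Z (fun _ ↦ P) P' where
  forall_aemeasurable := hX'
  aemeasurable_limit := h.aemeasurable_limit
  tendsto := h.tendsto.congr' (hXX'.mono fun _ hi ↦ Subtype.ext (Measure.map_congr hi))

lemma tendstoInDistribution_of_identDistrib_limit {Ω'' : Type*} [MeasurableSpace Ω'']
    {P'' : Measure Ω''} [IsProbabilityMeasure P''] {W : Ω'' → G}
    (h : TendstoInDistribution X l Z (fun _ ↦ P) P') (hZW : IdentDistrib Z W P' P'') :
    TendstoInDistribution X l W (fun _ ↦ P) P'' where
  forall_aemeasurable := h.forall_aemeasurable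
  aemeasurable_limit := hZW.aemeasurable_snd
  tendsto := by
    have hlaw : (⟨P'.map Z, Measure.isProbabilityMeasure_map h.aemeasurable_limit⟩ :
        ProbabilityMeasure G) =
          ⟨P''.map W, Measure.isProbabilityMeasure_map hZW.aemeasurable_snd⟩ :=
      Subtype.ext hZW.map_eq
    exact hlaw ▸ h.tendsto

end Topological

lemma tendstoInMeasure_of_tendstoInDistribution_const [PseudoMetricSpace G] [MeasurableSpace G]
    [BorelSpace G] {X : ι → Ω → G} {c : G}
    (h : TendstoInDistribution X l (fun _ : Ω' ↦ c) (fun _ ↦ P) P') :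
    TendstoInMeasure P X l (fun _ ↦ c) := by
  refine tendstoInMeasure_iff_dist.2 fun ε hε ↦ ?_
  have hclosed : IsClosed {x | ε ≤ dist x c} := isClosed_le (by fun_prop) (by fun_prop)
  have hc : c ∉ frontier {x | ε ≤ dist x c} := fun hc ↦
    hε.not_ge (by simpa using hclosed.frontier_subset hc)
  have htendsto := ProbabilityMeasure.tendsto_measure_of_null_frontier_of_tendsto' h.tendsto
    (E := {x | ε ≤ dist x c}) (by simp [hc, isClosed_frontier.measurableSet])
  simp only [ProbabilityMeasure.coe_mk,
    Measure.map_apply_of_aemeasurable (h.forall_aemeasurable _) hclosed.measurableSet] at htendsto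
  simpa [hε.not_ge, hclosed.measurableSet] using htendsto

lemma tendstoInMeasure_comp_of_continuousAt {E F : Type*} [PseudoMetricSpace E]
    [PseudoMetricSpace F] {μ : Measure Ω} {T : ι → Ω → E} {c : E} {u : E → F}
    (h : TendstoInMeasure μ T l (fun _ ↦ c)) (hu : ContinuousAt u c) :
    TendstoInMeasure μ (fun i ω ↦ u (T i ω)) l (fun _ ↦ u c) := by
  rw [tendstoInMeasure_iff_dist] at h ⊢
  intro ε hε
  obtain ⟨δ, hδ, hball⟩ := Metric.continuousAt_iff.1 hu ε hε
  refine tendsto_of_tendsto_of_tendsto_of_le_of_le tendsto_const_nhds (h δ hδ)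
    (fun _ ↦ zero_le) fun i ↦ measure_mono fun ω hω ↦ ?_
  exact not_lt.1 fun hlt ↦ (hball hlt).not_ge hω

end ConvergenceInDistribution

section DeltaMethod

variable {E F : Type*} [NormedAddCommGroup E] [NormedSpace ℝ E] [NormedAddCommGroup F]
  [NormedSpace ℝ F] {g : E → F} {g' : E →L[ℝ] F} {θ : E}

/-- The remainder of the first order expansion of `g` at `θ`, relative to the size of the
increment; differentiability of `g` at `θ` is continuity of this function at `θ`. -/
noncomputable def relRemainder (g : E → F) (g' : E →L[ℝ] F) (θ x : E) : F :=
  ‖x - θ‖⁻¹ • (g x - g θ - g' (x - θ))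

lemma relRemainder_self : relRemainder g g' θ θ = 0 := by
  simp [relRemainder]

lemma continuousAt_relRemainder (hg : HasFDerivAt g g' θ) :
    ContinuousAt (relRemainder g g' θ) θ := by
  rw [hasFDerivAt_iff_tendsto] at hg
  rw [ContinuousAt, relRemainder_self, tendsto_zero_iff_norm_tendsto_zero]
  simpa only [relRemainder, norm_smul, norm_inv, norm_norm] using hg

lemma smul_sub_eq_add_norm_smul_relRemainder {r : ℝ} (hr : 0 ≤ r) (x : E) :
    r • (g x - g θ) = g' (r • (x - θ)) + ‖r • (x - θ)‖ • relRemainder g g' θ x := by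
  obtain rfl | hx := eq_or_ne x θ
  · simp
  · have hne : ‖x - θ‖ ≠ 0 := norm_ne_zero_iff.2 (sub_ne_zero.2 hx)
    rw [relRemainder, norm_smul, Real.norm_of_nonneg hr, smul_smul, mul_inv_cancel_right₀ hne,
      map_smul, ← smul_add, add_sub_cancel]

variable {Ω Ω' : Type*} [MeasurableSpace Ω] {P : Measure Ω} [IsProbabilityMeasure P]
  [MeasurableSpace Ω'] {P' : Measure Ω'} [IsProbabilityMeasure P']
  [MeasurableSpace E] [BorelSpace E] [SecondCountableTopology E]
  [MeasurableSpace F] [BorelSpace F] [SecondCountableTopology F]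
  {T : ℕ → Ω → E} {Z : Ω' → E} {r : ℕ → ℝ}

lemma tendstoInMeasure_of_tendstoInDistribution_smul_sub (hr : Tendsto r atTop atTop)
    (hT : ∀ n, AEMeasurable (T n) P)
    (hTZ : TendstoInDistribution (fun n ω ↦ r n • (T n ω - θ)) atTop Z (fun _ ↦ P) P') :
    TendstoInMeasure P T atTop (fun _ ↦ θ) := by
  have hinv : TendstoInMeasure P (fun n (_ : Ω) ↦ (r n)⁻¹) atTop (fun _ ↦ (0 : ℝ)) :=
    tendstoInMeasure_of_tendsto_ae (fun _ ↦ aestronglyMeasurable_const)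
      (ae_of_all _ fun _ ↦ hr.inv_tendsto_atTop)
  have hslutsky := hTZ.continuous_comp_prodMk_of_tendstoInMeasure_const
    (g := fun q : E × ℝ ↦ q.2 • q.1 + θ) (by fun_prop) hinv (fun _ ↦ aemeasurable_const)
  simp only [zero_smul, zero_add] at hslutsky
  refine tendstoInMeasure_of_tendstoInDistribution_const
    (tendstoInDistribution_of_eventuallyEq hslutsky hT ?_)
  filter_upwards [hr.eventually_ne_atTop 0] with n hn
  exact ae_of_all _ fun ω ↦ by simp [inv_smul_smul₀ hn]

theorem tendstoInDistribution_smul_comp_sub (hr : Tendsto r atTop atTop)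
    (hT : ∀ n, AEMeasurable (T n) P)
    (hTZ : TendstoInDistribution (fun n ω ↦ r n • (T n ω - θ)) atTop Z (fun _ ↦ P) P')
    (hg : Measurable g) (hg' : HasFDerivAt g g' θ) :
    TendstoInDistribution (fun n ω ↦ r n • (g (T n ω) - g θ)) atTop (fun ω ↦ g' (Z ω))
      (fun _ ↦ P) P' := by
  have hrem : TendstoInMeasure P (fun n ω ↦ relRemainder g g' θ (T n ω)) atTop (fun _ ↦ 0) :=
    relRemainder_self (g := g) (g' := g') (θ := θ) ▸ tendstoInMeasure_comp_of_continuousAt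
      (tendstoInMeasure_of_tendstoInDistribution_smul_sub hr hT hTZ)
      (continuousAt_relRemainder hg')
  have hslutsky := hTZ.continuous_comp_prodMk_of_tendstoInMeasure_const
    (g := fun q : E × F ↦ g' q.1 + ‖q.1‖ • q.2) (by fun_prop) hrem
    (fun n ↦ by unfold relRemainder; fun_prop)
  simp only [smul_zero, add_zero] at hslutsky
  refine tendstoInDistribution_of_eventuallyEq hslutsky (fun n ↦ by fun_prop) ?_
  filter_upwards [hr.eventually_ge_atTop 0] with n hn
  exact ae_of_all _ fun ω ↦ (smul_sub_eq_add_norm_smul_relRemainder hn _).symm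

end DeltaMethod

section SmoothFunctionOfMeans

variable {Ω E κ : Type*} [MeasurableSpace Ω] {P : Measure Ω} [IsProbabilityMeasure P]
  [NormedAddCommGroup E] [NormedSpace ℝ E] [FiniteDimensional ℝ E] [MeasurableSpace E]
  [BorelSpace E] [Fintype κ] [DecidableEq κ] {ξ : ℕ → Ω → E}

theorem tendstoInDistribution_sqrt_smul_comp_average_sub (hξ : MemLp (ξ 0) 2 P)
    (hindep : iIndepFun ξ P) (hident : ∀ i, IdentDistrib (ξ i) (ξ 0) P P)
    {g : E → EuclideanSpace ℝ κ} {g' : E →L[ℝ] EuclideanSpace ℝ κ} (hg : Measurable g)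
    (hg' : HasFDerivAt g g' P[ξ 0]) {Ψ : Matrix κ κ ℝ} (hΨ : Ψ.PosSemidef)
    (hvar : ∀ t : EuclideanSpace ℝ κ,
      Var[fun ω ↦ ⟪t, g' (ξ 0 ω)⟫; P] = t.ofLp ⬝ᵥ Ψ *ᵥ t.ofLp) :
    TendstoInDistribution
      (fun (n : ℕ) ω ↦ √n • (g ((n : ℝ)⁻¹ • ∑ i ∈ Finset.range n, ξ i ω) - g P[ξ 0]))
      atTop id (fun _ ↦ P) (multivariateGaussian 0 Ψ) := by
  have := FiniteDimensional.proper_real E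
  set e : E ≃L[ℝ] EuclideanSpace ℝ (Fin (Module.finrank ℝ E)) := toEuclidean
  have hmeas (i : ℕ) : AEMeasurable (ξ i) P := (hident i).aemeasurable_fst
  have heξ : MemLp (fun ω ↦ e (ξ 0 ω)) 2 P := e.toContinuousLinearMap.comp_memLp' hξ
  have hmean : P[fun ω ↦ e (ξ 0 ω)] = e P[ξ 0] := e.integral_comp_comm (ξ 0)
  have hclt := (tendstoInDistribution_inv_sqrt_smul_sum_sub (ξ := fun i ω ↦ e (ξ i ω)) heξ
    (hindep.comp (fun _ ↦ e) fun _ ↦ e.continuous.measurable)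
    (fun i ↦ (hident i).comp e.continuous.measurable)).continuous_comp e.symm.continuous
  have hdelta := tendstoInDistribution_smul_comp_sub (r := fun n : ℕ ↦ √n)
    (T := fun n ω ↦ (n : ℝ)⁻¹ • ∑ i ∈ Finset.range n, ξ i ω)
    (Real.tendsto_sqrt_atTop.comp tendsto_natCast_atTop_atTop) (fun n ↦ by fun_prop)
    (hclt.congr (fun n ↦ ae_of_all _ fun ω ↦ ?_) ae_eq_rfl) hg hg'
  · refine tendstoInDistribution_of_identDistrib_limit hdelta
      ⟨by fun_prop, by fun_prop, ?_⟩
    rw [Measure.map_id]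
    exact map_multivariateGaussian_covMat heξ (g' ∘L e.symm.toContinuousLinearMap) hΨ
      (by simpa using hvar)
  · have hsqrt : √(n : ℝ) * (n : ℝ)⁻¹ = (√n)⁻¹ := by
      rw [← div_eq_mul_inv, Real.sqrt_div_self', one_div]
    have hsqrt' : (√n)⁻¹ * (n : ℝ) = √n := by rw [mul_comm, ← div_eq_mul_inv, Real.div_sqrt]
    simp only [Function.comp_apply, hmean, map_smul, map_sub, map_sum, e.symm_apply_apply,
      smul_sub, smul_smul, hsqrt, hsqrt']

end SmoothFunctionOfMeans

section RingInverse

lemma ringInverse_smul {𝕜 R : Type*} [Field 𝕜] [Ring R] [Algebra 𝕜 R] (c : 𝕜) (a : R) :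
    Ring.inverse (c • a) = c⁻¹ • Ring.inverse a := by
  obtain rfl | hc := eq_or_ne c 0
  · simp
  have hu : IsUnit (algebraMap 𝕜 R c) := hc.isUnit.map _
  rw [Algebra.smul_def, Algebra.commutes, Ring.inverse_mul (.inr hu),
    Ring.inverse_mul_eq_iff_eq_mul _ _ _ hu, ← Algebra.smul_def, smul_inv_smul₀ hc]

lemma map_ringInverse {M N E : Type*} [MonoidWithZero M] [MonoidWithZero N] [EquivLike E M N]
    [MulEquivClass E M N] (e : E) (a : M) : e (Ring.inverse a) = Ring.inverse (e a) := by
  by_cases ha : IsUnit a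
  · rw [← mul_one (Ring.inverse (e a)), eq_comm,
      Ring.inverse_mul_eq_iff_eq_mul _ _ _ (ha.map e), ← map_mul, Ring.mul_inverse_cancel _ ha,
      map_one]
  · rw [Ring.inverse_non_unit _ ha, Ring.inverse_non_unit _ (by rwa [isUnit_map_iff]),
      map_zero]

lemma measurable_ringInverse {R : Type*} [NormedRing R] [CompleteSpace R] [MeasurableSpace R]
    [BorelSpace R] : Measurable (Ring.inverse : R → R) := by
  classical
  have hpiecewise : Ring.inverse = {a : R | IsUnit a}.piecewise Ring.inverse 0 := by
    ext a
    by_cases ha : IsUnit a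
    · simp [ha]
    · simp [ha, Ring.inverse_non_unit]
  rw [hpiecewise]
  exact ContinuousOn.measurable_piecewise
    (fun a ha ↦ NormedRing.inverse_continuousAt ha.unit |>.continuousWithinAt)
    continuousOn_const Units.isOpen.measurableSet

lemma hasDerivAt_ringInverse_apply {F : Type*} [NormedAddCommGroup F] [NormedSpace ℝ F]
    [CompleteSpace F] {B : ℝ → F →L[ℝ] F} {B' : F →L[ℝ] F} {v : ℝ → F} {v' : F} {t : ℝ}
    (hBt : IsUnit (B t)) (hB : HasDerivAt B B' t)
    (hv : HasDerivAt v v' t) :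
    HasDerivAt (fun t ↦ Ring.inverse (B t) (v t))
      (Ring.inverse (B t) (v' - B' (Ring.inverse (B t) (v t)))) t := by
  obtain ⟨u, hu⟩ := hBt
  have hinv := (hu ▸ hasFDerivAt_ringInverse (𝕜 := ℝ) u).comp_hasDerivAt t hB
  convert! hinv.clm_apply hv using 1
  simp [← hu, sub_eq_neg_add]

end RingInverse

section EuclideanCLM

variable {ι : Type*} [Fintype ι] [DecidableEq ι] {A : Matrix ι ι ℝ}

lemma isUnit_toEuclideanCLM (hA : A.PosDef) : IsUnit (toEuclideanCLM (𝕜 := ℝ) A) :=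
  hA.isUnit.map (toEuclideanCLM (𝕜 := ℝ) (n := ι))

lemma inner_toEuclideanCLM_comm (hA : A.IsHermitian) (s w : EuclideanSpace ℝ ι) :
    ⟪s, toEuclideanCLM (𝕜 := ℝ) A w⟫ = ⟪toEuclideanCLM (𝕜 := ℝ) A s, w⟫ :=
  ((hA.isSelfAdjoint.map (toEuclideanCLM (𝕜 := ℝ) (n := ι))).isSymmetric s w).symm

lemma toEuclideanCLM_inv (A : Matrix ι ι ℝ) :
    toEuclideanCLM (𝕜 := ℝ) A⁻¹ = Ring.inverse (toEuclideanCLM (𝕜 := ℝ) A) := by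
  rw [nonsing_inv_eq_ringInverse, map_ringInverse]

end EuclideanCLM

section InnerProductSpace

variable {F : Type*} [NormedAddCommGroup F] [InnerProductSpace ℝ F]

lemma isBoundedBilinearMap_rankOne :
    IsBoundedBilinearMap ℝ fun q : F × F ↦ rankOne ℝ q.1 q.2 where
  add_left := by simp
  add_right := by simp
  smul_left := by simp
  smul_right := by simp
  bound := ⟨1, one_pos, by simp⟩

lemma measurable_rankOne_self [MeasurableSpace F] [BorelSpace F] :
    Measurable fun v : F ↦ rankOne ℝ v v :=
  (isBoundedBilinearMap_rankOne.continuous.comp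
    (by fun_prop : Continuous fun v : F ↦ (v, v))).measurable

lemma hasFDerivAt_normalize {v : F} (hv : v ≠ 0) :
    HasFDerivAt NormedSpace.normalize
      (‖v‖⁻¹ • (1 - (‖v‖ ^ 2)⁻¹ • rankOne ℝ v v) : F →L[ℝ] F) v := by
  have hnorm : ‖v‖ ≠ 0 := norm_ne_zero_iff.2 hv
  have hnorm' : HasFDerivAt (fun x : F ↦ ‖x‖) (‖v‖⁻¹ • innerSL ℝ v) v := by
    convert! (hasStrictFDerivAt_norm_sq v).hasFDerivAt.sqrt (by positivity) using 1
    · simp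
    · simp only [one_div, _root_.mul_inv_rev, norm_nonneg, Real.sqrt_sq]
      module
  have hinv := (hasDerivAt_inv hnorm).comp_hasFDerivAt v hnorm'
  convert! hinv.smul (hasFDerivAt_id v) using 1
  ext x
  simp only [smul_sub, smul_smul, _root_.sub_apply, _root_.smul_apply, one_apply_eq_self,
    rankOne_apply, Function.comp_apply, neg_mul, neg_smul, id_eq, _root_.add_apply,
    ContinuousLinearMap.id_apply, ContinuousLinearMap.smulRight_apply, _root_.neg_apply,
    coe_innerSL_apply, smul_eq_mul]
  module

end InnerProductSpace

section Moments

variable {F : Type*} [NormedAddCommGroup F] [InnerProductSpace ℝ F]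

/-- The space of moments from which the discriminant direction is computed: total weight and
weighted sum of the first group, the same for the second group, and the uncentred second moment of
all observations. Second moments are operators, not matrices, so that `F` can be any inner product
space. -/
abbrev MomentSpace (F : Type*) [NormedAddCommGroup F] [InnerProductSpace ℝ F] : Type _ :=
  (ℝ × F) × (ℝ × F) × (F →L[ℝ] F)

/-- The contribution of one observation `x` with label `y` to the sample moments. -/
noncomputable def observationMoments (x : F) (y : ℝ) : MomentSpace F :=
  ((y, y • x), (1 - y, (1 - y) • x), rankOne ℝ x x)

/-- The mean of a group of total weight `q.1` and weighted sum `q.2`; like `weightedMean`, it is `0`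
for an empty group. -/
noncomputable def groupMean (q : ℝ × F) : F := q.1⁻¹ • q.2

/-- The within-group scatter operator, obtained from the uncentred second moment by subtracting the
second moments of the two group means. -/
noncomputable def withinScatter (m : MomentSpace F) : F →L[ℝ] F :=
  m.2.2 - (m.1.1 • rankOne ℝ (groupMean m.1) (groupMean m.1) +
    m.2.1.1 • rankOne ℝ (groupMean m.2.1) (groupMean m.2.1))

/-- The discriminant direction as a function of the moments. `Ring.inverse` is `0` on non-units,
which matches the convention for inverses of singular matrices. -/
noncomputable def direction (m : MomentSpace F) : F :=
  Ring.inverse (withinScatter m) (groupMean m.2.1 - groupMean m.1)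

/-- The unit vector in the discriminant direction as a function of the moments, the map to which
the delta method is applied. -/
noncomputable def unitDirection (m : MomentSpace F) : F := NormedSpace.normalize (direction m)

/-- The moments of a mixture of two populations with weights `a` and `b`, means `μ₁` and `μ₂` and
common covariance operator `A`. -/
noncomputable def populationMoments (a b : ℝ) (μ₁ μ₂ : F) (A : F →L[ℝ] F) : MomentSpace F :=
  ((a, a • μ₁), (b, b • μ₂), A + (a • rankOne ℝ μ₁ μ₁ + b • rankOne ℝ μ₂ μ₂))

variable {a b : ℝ} {μ₁ μ₂ : F} {A : F →L[ℝ] F}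

lemma groupMean_mk_smul (ha : a ≠ 0) (μ : F) : groupMean (a, a • μ) = μ :=
  inv_smul_smul₀ ha μ

lemma groupMean_smul {c : ℝ} (hc : c ≠ 0) (q : ℝ × F) : groupMean (c • q) = groupMean q := by
  simp [groupMean, smul_smul, hc]

lemma withinScatter_smul {c : ℝ} (hc : c ≠ 0) (m : MomentSpace F) :
    withinScatter (c • m) = c • withinScatter m := by
  simp [withinScatter, groupMean_smul hc, smul_sub, smul_smul]

lemma direction_smul {c : ℝ} (hc : c ≠ 0) (m : MomentSpace F) :
    direction (c • m) = c⁻¹ • direction m := by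
  simp [direction, withinScatter_smul hc, groupMean_smul hc, ringInverse_smul]

lemma withinScatter_populationMoments (ha : a ≠ 0) (hb : b ≠ 0) :
    withinScatter (populationMoments a b μ₁ μ₂ A) = A := by
  simp [withinScatter, populationMoments, groupMean_mk_smul, ha, hb]

lemma direction_populationMoments (ha : a ≠ 0) (hb : b ≠ 0) :
    direction (populationMoments a b μ₁ μ₂ A) = Ring.inverse A (μ₂ - μ₁) := by
  rw [direction, withinScatter_populationMoments ha hb, populationMoments, groupMean_mk_smul ha,
    groupMean_mk_smul hb]

lemma sum_smul_rankOne_sub_groupMean {ι : Type*} (s : Finset ι) (x : ι → F) (w : ι → ℝ)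
    {g : F} (hg : g = groupMean (∑ i ∈ s, w i, ∑ i ∈ s, w i • x i)) :
    ∑ i ∈ s, w i • rankOne ℝ (x i - g) (x i - g) =
      ∑ i ∈ s, w i • rankOne ℝ (x i) (x i) - (∑ i ∈ s, w i) • rankOne ℝ g g := by
  obtain hw | hw := eq_or_ne (∑ i ∈ s, w i) 0
  · have hg₀ : g = 0 := by rw [hg, groupMean, hw, _root_.inv_zero, zero_smul]
    simp [hg₀]
  have hsum : ∑ i ∈ s, w i • x i = (∑ i ∈ s, w i) • g := by rw [hg, groupMean, smul_inv_smul₀ hw]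
  have hexpand (i : ι) : w i • rankOne ℝ (x i - g) (x i - g) =
      w i • rankOne ℝ (x i) (x i) - rankOne ℝ (w i • x i) g - rankOne ℝ g (w i • x i) +
        w i • rankOne ℝ g g := by
    simp only [map_sub, _root_.sub_apply, map_smul, _root_.smul_apply]
    module
  have hleft : ∑ i ∈ s, rankOne ℝ (w i • x i) g = (∑ i ∈ s, w i) • rankOne ℝ g g := by
    rw [← _root_.sum_apply, ← map_sum, hsum, map_smul]
    rfl
  have hright : ∑ i ∈ s, rankOne ℝ g (w i • x i) = (∑ i ∈ s, w i) • rankOne ℝ g g := by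
    rw [← map_sum, hsum, map_smulₛₗ]
    simp
  simp_rw [hexpand, Finset.sum_add_distrib, Finset.sum_sub_distrib, hleft, hright,
    ← Finset.sum_smul]
  abel

section Derivative

lemma differentiableAt_groupMean {q : ℝ × F} (hq : q.1 ≠ 0) : DifferentiableAt ℝ groupMean q := by
  unfold groupMean
  fun_prop (disch := assumption)

lemma differentiableAt_withinScatter {m : MomentSpace F} (h₁ : m.1.1 ≠ 0) (h₂ : m.2.1.1 ≠ 0) :
    DifferentiableAt ℝ withinScatter m := by
  have hrank {q : MomentSpace F → ℝ × F} (hq : DifferentiableAt ℝ q m) (hqm : (q m).1 ≠ 0) :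
      DifferentiableAt ℝ (fun m ↦ rankOne ℝ (groupMean (q m)) (groupMean (q m))) m := by
    have := (differentiableAt_groupMean hqm).comp m hq
    exact (isBoundedBilinearMap_rankOne.differentiableAt _).comp m (this.prodMk this)
  have := hrank (q := fun m ↦ m.1) (by fun_prop) h₁
  have := hrank (q := fun m ↦ m.2.1) (by fun_prop) h₂
  unfold withinScatter
  fun_prop

lemma differentiableAt_direction [CompleteSpace F] {m : MomentSpace F} (h₁ : m.1.1 ≠ 0)
    (h₂ : m.2.1.1 ≠ 0) (hm : IsUnit (withinScatter m)) : DifferentiableAt ℝ direction m := by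
  have := (differentiableAt_inverse (𝕜 := ℝ) hm).comp m (differentiableAt_withinScatter h₁ h₂)
  have := (differentiableAt_groupMean h₁).comp m differentiableAt_fst
  have := (differentiableAt_groupMean h₂).comp (f := fun m : MomentSpace F ↦ m.2.1) m (by fun_prop)
  unfold direction
  fun_prop

lemma hasFDerivAt_unitDirection [CompleteSpace F] {m : MomentSpace F} (h₁ : m.1.1 ≠ 0)
    (h₂ : m.2.1.1 ≠ 0) (hm : IsUnit (withinScatter m)) (hdir : direction m ≠ 0) :
    HasFDerivAt unitDirection
      ((‖direction m‖⁻¹ • (1 - (‖direction m‖ ^ 2)⁻¹ • rankOne ℝ (direction m) (direction m))) ∘L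
        fderiv ℝ direction m) m :=
  (hasFDerivAt_normalize hdir).comp m (differentiableAt_direction h₁ h₂ hm).hasFDerivAt

lemma hasDerivAt_groupMean {q : ℝ → ℝ × F} {q' : ℝ × F} {t : ℝ} {μ : F} (ha : a ≠ 0)
    (hqt : q t = (a, a • μ)) (hq : HasDerivAt q q' t) :
    HasDerivAt (fun t ↦ groupMean (q t)) (a⁻¹ • (q'.2 - q'.1 • μ)) t := by
  have h1 : HasDerivAt (fun t ↦ (q t).1) q'.1 t := hq.fst
  have h2 : HasDerivAt (fun t ↦ (q t).2) q'.2 t := hq.snd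
  convert! (h1.fun_inv (by simpa [hqt])).fun_smul h2 using 1
  simp only [hqt, smul_sub, smul_smul]
  field_simp
  module

lemma hasDerivAt_smul_rankOne_groupMean {q : ℝ → ℝ × F} {q' : ℝ × F} {t : ℝ} {μ : F}
    (ha : a ≠ 0) (hqt : q t = (a, a • μ)) (hq : HasDerivAt q q' t) :
    HasDerivAt (fun t ↦ (q t).1 • rankOne ℝ (groupMean (q t)) (groupMean (q t)))
      (rankOne ℝ q'.2 μ + rankOne ℝ μ q'.2 - q'.1 • rankOne ℝ μ μ) t := by
  have hμ := hasDerivAt_groupMean ha hqt hq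
  have hmean : groupMean (q t) = μ := by rw [hqt, groupMean_mk_smul ha]
  have hrank := (isBoundedBilinearMap_rankOne.hasFDerivAt _).comp_hasDerivAt t (hμ.prodMk hμ)
  have hweight : HasDerivAt (fun t ↦ (q t).1) q'.1 t := hq.fst
  convert! hweight.fun_smul hrank using 1
  simp only [IsBoundedBilinearMap.deriv_apply, Function.comp_apply, hmean]
  simp only [hqt, map_smul, map_sub, _root_.smul_apply, _root_.sub_apply, smul_add, smul_smul,
    ne_eq, ha, not_false_eq_true, mul_inv_cancel₀, one_smul]
  module

lemma hasDerivAt_withinScatter {m : ℝ → MomentSpace F} {m' : MomentSpace F} {t : ℝ}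
    (ha : a ≠ 0) (hb : b ≠ 0) (hmt : m t = populationMoments a b μ₁ μ₂ A)
    (hm : HasDerivAt m m' t) :
    HasDerivAt (fun t ↦ withinScatter (m t))
      (m'.2.2 - ((rankOne ℝ m'.1.2 μ₁ + rankOne ℝ μ₁ m'.1.2 - m'.1.1 • rankOne ℝ μ₁ μ₁) +
        (rankOne ℝ m'.2.1.2 μ₂ + rankOne ℝ μ₂ m'.2.1.2 - m'.2.1.1 • rankOne ℝ μ₂ μ₂))) t := by
  have h₁ := hasDerivAt_smul_rankOne_groupMean (μ := μ₁) ha (by rw [hmt, populationMoments]) hm.fst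
  have h₂ := hasDerivAt_smul_rankOne_groupMean (μ := μ₂) hb (by rw [hmt, populationMoments])
    hm.snd.fst
  have hsecond : HasDerivAt (fun t ↦ (m t).2.2) m'.2.2 t := hm.snd.snd
  exact hsecond.fun_sub (h₁.fun_add h₂)

lemma hasDerivAt_direction [CompleteSpace F] {m : ℝ → MomentSpace F} {m' : MomentSpace F} {t : ℝ}
    (ha : a ≠ 0) (hb : b ≠ 0) (hA : IsUnit A) (hmt : m t = populationMoments a b μ₁ μ₂ A)
    (hm : HasDerivAt m m' t) :
    HasDerivAt (fun t ↦ direction (m t))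
      (Ring.inverse A (b⁻¹ • (m'.2.1.2 - m'.2.1.1 • μ₂) - a⁻¹ • (m'.1.2 - m'.1.1 • μ₁) -
        (m'.2.2 - ((rankOne ℝ m'.1.2 μ₁ + rankOne ℝ μ₁ m'.1.2 - m'.1.1 • rankOne ℝ μ₁ μ₁) +
          (rankOne ℝ m'.2.1.2 μ₂ + rankOne ℝ μ₂ m'.2.1.2 - m'.2.1.1 • rankOne ℝ μ₂ μ₂)))
            (Ring.inverse A (μ₂ - μ₁)))) t := by
  have hscatter : withinScatter (m t) = A := by rw [hmt, withinScatter_populationMoments ha hb]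
  have hq₁ : (m t).1 = (a, a • μ₁) := by rw [hmt, populationMoments]
  have hq₂ : (m t).2.1 = (b, b • μ₂) := by rw [hmt, populationMoments]
  have hmean₁ : HasDerivAt (fun t ↦ groupMean (m t).1) _ t := hasDerivAt_groupMean ha hq₁ hm.fst
  have hmean₂ : HasDerivAt (fun t ↦ groupMean (m t).2.1) _ t :=
    hasDerivAt_groupMean hb hq₂ hm.snd.fst
  convert! hasDerivAt_ringInverse_apply (by rwa [hscatter])
    (hasDerivAt_withinScatter ha hb hmt hm) (hmean₂.fun_sub hmean₁) using 1
  rw [hscatter, hq₁, hq₂, groupMean_mk_smul ha, groupMean_mk_smul hb]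

lemma fderiv_direction_populationMoments [CompleteSpace F] (ha : a ≠ 0) (hb : b ≠ 0)
    (hA : IsUnit A) (m' : MomentSpace F) :
    fderiv ℝ direction (populationMoments a b μ₁ μ₂ A) m' =
      Ring.inverse A (b⁻¹ • (m'.2.1.2 - m'.2.1.1 • μ₂) - a⁻¹ • (m'.1.2 - m'.1.1 • μ₁) -
        (m'.2.2 - ((rankOne ℝ m'.1.2 μ₁ + rankOne ℝ μ₁ m'.1.2 - m'.1.1 • rankOne ℝ μ₁ μ₁) +
          (rankOne ℝ m'.2.1.2 μ₂ + rankOne ℝ μ₂ m'.2.1.2 - m'.2.1.1 • rankOne ℝ μ₂ μ₂)))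
            (Ring.inverse A (μ₂ - μ₁))) := by
  set m₀ := populationMoments a b μ₁ μ₂ A with hm₀
  have hline : HasDerivAt (fun t : ℝ ↦ m₀ + t • m') m' 0 := by
    simpa using ((hasDerivAt_id (0 : ℝ)).smul_const m').const_add m₀
  have hline₀ : m₀ + (0 : ℝ) • m' = m₀ := by rw [zero_smul, add_zero]
  have hdiff : DifferentiableAt ℝ direction m₀ :=
    differentiableAt_direction ha hb (by rwa [hm₀, withinScatter_populationMoments ha hb])
  have hchain : HasDerivAt (fun t : ℝ ↦ direction (m₀ + t • m')) (fderiv ℝ direction m₀ m') 0 :=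
    hdiff.hasFDerivAt.hasLineDerivAt m'
  exact hchain.unique (hasDerivAt_direction ha hb hA (hline₀.trans hm₀) hline)

lemma fderiv_direction_observationMoments_one [CompleteSpace F] (ha : a ≠ 0) (hb : b ≠ 0)
    (hA : IsUnit A) (x : F) :
    fderiv ℝ direction (populationMoments a b μ₁ μ₂ A) (observationMoments x 1) =
      Ring.inverse A (-(a⁻¹ + ⟪Ring.inverse A (μ₂ - μ₁), x - μ₁⟫) • (x - μ₁)) := by
  rw [fderiv_direction_populationMoments ha hb hA]
  generalize Ring.inverse A (μ₂ - μ₁) = θ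
  congr 1
  simp only [observationMoments, one_smul, sub_self, zero_smul, smul_zero, zero_sub, map_zero,
    _root_.zero_apply, add_zero, _root_.sub_apply, rankOne_apply, _root_.add_apply,
    inner_sub_right, real_inner_comm]
  module

lemma fderiv_direction_observationMoments_zero [CompleteSpace F] (ha : a ≠ 0) (hb : b ≠ 0)
    (hA : IsUnit A) (x : F) :
    fderiv ℝ direction (populationMoments a b μ₁ μ₂ A) (observationMoments x 0) =
      Ring.inverse A ((b⁻¹ - ⟪Ring.inverse A (μ₂ - μ₁), x - μ₂⟫) • (x - μ₂)) := by
  rw [fderiv_direction_populationMoments ha hb hA]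
  generalize Ring.inverse A (μ₂ - μ₁) = θ
  congr 1
  simp only [observationMoments, zero_smul, sub_zero, one_smul, sub_self, smul_zero, map_zero,
    _root_.zero_apply, add_zero, zero_add, _root_.sub_apply, rankOne_apply, _root_.add_apply,
    inner_sub_right, real_inner_comm]
  module

end Derivative

section Measurability

variable [MeasurableSpace F] [BorelSpace F] [FiniteDimensional ℝ F]

@[fun_prop]
lemma measurable_groupMean : Measurable (groupMean : ℝ × F → F) := by
  have := FiniteDimensional.proper_real F
  unfold groupMean
  fun_prop

lemma measurable_withinScatter : Measurable (withinScatter : MomentSpace F → F →L[ℝ] F) := by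
  have := FiniteDimensional.proper_real F
  have hrank : Measurable fun q : ℝ × F ↦ rankOne ℝ (groupMean q) (groupMean q) :=
    measurable_rankOne_self.comp measurable_groupMean
  have h₁ : Measurable fun m : MomentSpace F ↦ rankOne ℝ (groupMean m.1) (groupMean m.1) :=
    hrank.comp measurable_fst
  have h₂ : Measurable fun m : MomentSpace F ↦ rankOne ℝ (groupMean m.2.1) (groupMean m.2.1) :=
    hrank.comp (measurable_fst.comp measurable_snd)
  unfold withinScatter
  fun_prop

lemma measurable_direction : Measurable (direction : MomentSpace F → F) := by
  have := FiniteDimensional.proper_real F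
  have := FiniteDimensional.complete ℝ F
  exact ContinuousLinearMap.measurable_apply₂.comp
    ((measurable_ringInverse.comp measurable_withinScatter).prodMk (by fun_prop))

lemma measurable_unitDirection : Measurable (unitDirection : MomentSpace F → F) := by
  have := FiniteDimensional.proper_real F
  have := measurable_direction (F := F)
  unfold unitDirection NormedSpace.normalize
  fun_prop

lemma measurable_observationMoments :
    Measurable fun q : ℝ × F ↦ observationMoments q.2 q.1 := by
  have := FiniteDimensional.proper_real F
  have : Measurable fun q : ℝ × F ↦ rankOne ℝ q.2 q.2 :=
    measurable_rankOne_self.comp measurable_snd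
  unfold observationMoments
  fun_prop

end Measurability

end Moments

section SampleMoments

variable {p : ℕ} (n : ℕ) (x : ℕ → EuclideanSpace ℝ (Fin p)) (y : ℕ → ℝ)

lemma toEuclideanCLM_outer (v : EuclideanSpace ℝ (Fin p)) :
    toEuclideanCLM (𝕜 := ℝ) (outer v) = rankOne ℝ v v := by
  ext w i
  simp [outer, ofLp_toEuclideanCLM, vecMulVec_mulVec, PiLp.inner_apply, dotProduct, mul_comm]

lemma mulVecE_inv (A : Matrix (Fin p) (Fin p) ℝ) (v : EuclideanSpace ℝ (Fin p)) :
    mulVecE A⁻¹ v = Ring.inverse (toEuclideanCLM (𝕜 := ℝ) A) v := by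
  rw [← toEuclideanCLM_inv]
  rfl

lemma sum_observationMoments :
    ∑ i ∈ Finset.range n, observationMoments (x i) (y i) =
      ((∑ i ∈ Finset.range n, y i, ∑ i ∈ Finset.range n, y i • x i),
        (∑ i ∈ Finset.range n, (1 - y i), ∑ i ∈ Finset.range n, (1 - y i) • x i),
        ∑ i ∈ Finset.range n, rankOne ℝ (x i) (x i)) := by
  simp [Prod.ext_iff, Prod.fst_sum, Prod.snd_sum, observationMoments]

lemma toEuclideanCLM_pooledCov :
    toEuclideanCLM (𝕜 := ℝ) (pooledCov n x y) =
      ((n : ℝ) - 2)⁻¹ • withinScatter (∑ i ∈ Finset.range n, observationMoments (x i) (y i)) := by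
  have h₁ := sum_smul_rankOne_sub_groupMean (Finset.range n) x y
    (g := mean₁ n x y) rfl
  have h₂ := sum_smul_rankOne_sub_groupMean (Finset.range n) x (fun i ↦ 1 - y i)
    (g := mean₂ n x y) rfl
  have hsplit : ∑ i ∈ Finset.range n, rankOne ℝ (x i) (x i) =
      ∑ i ∈ Finset.range n, y i • rankOne ℝ (x i) (x i) +
        ∑ i ∈ Finset.range n, (1 - y i) • rankOne ℝ (x i) (x i) := by
    simp only [← Finset.sum_add_distrib, ← add_smul, add_sub_cancel, one_smul]
  rw [sum_observationMoments, withinScatter, hsplit]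
  simp only [pooledCov, map_smul, map_add, map_sum, toEuclideanCLM_outer, h₁, h₂]
  rw [add_sub_add_comm]
  rfl

lemma ldaEstimator_eq_smul_direction :
    ldaEstimator n x y = ((n : ℝ) - 2) •
      direction (∑ i ∈ Finset.range n, observationMoments (x i) (y i)) := by
  have hinv := ringInverse_smul ((n : ℝ) - 2)⁻¹
    (withinScatter (∑ i ∈ Finset.range n, observationMoments (x i) (y i)))
  rw [_root_.inv_inv] at hinv
  rw [ldaEstimator, mulVecE_inv, toEuclideanCLM_pooledCov, hinv, direction, sum_observationMoments]
  rfl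

lemma unit_ldaEstimator {n : ℕ} (hn : 2 < n) :
    unit (ldaEstimator n x y) =
      unitDirection ((n : ℝ)⁻¹ • ∑ i ∈ Finset.range n, observationMoments (x i) (y i)) := by
  have hn₀ : (0 : ℝ) < n := by positivity
  have hn₂ : (0 : ℝ) < n - 2 := sub_pos.2 (by exact_mod_cast hn)
  rw [ldaEstimator_eq_smul_direction, unitDirection, direction_smul (inv_pos.2 hn₀).ne',
    _root_.inv_inv, NormedSpace.normalize_smul_of_pos hn₀]
  exact NormedSpace.normalize_smul_of_pos hn₂ _

end SampleMoments

section BernoulliCompProd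

variable {α β G : Type*} [MeasurableSpace α] [MeasurableSingletonClass α] [MeasurableSpace β]
  {κ : Kernel α β} [IsFiniteKernel κ] {u v : α} {q : unitInterval}
  [NormedAddCommGroup G] {f : α × β → G}

lemma dirac_compProd (a : α) : Measure.dirac a ⊗ₘ κ = (κ a).map (Prod.mk a) := by
  ext s hs
  rw [Measure.dirac_compProd_apply hs, Measure.map_apply measurable_prodMk_left hs]

lemma bernoulliMeasure_compProd : bernoulliMeasure u v q ⊗ₘ κ =
    unitInterval.toNNReal q • (κ u).map (Prod.mk u) +
      unitInterval.toNNReal (unitInterval.symm q) • (κ v).map (Prod.mk v) := by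
  simp only [bernoulliMeasure_def, Measure.compProd_add_left, ENNReal.smul_def, dirac_compProd,
    Measure.compProd_smul_left]

lemma integrable_bernoulliMeasure_compProd (hf : StronglyMeasurable f)
    (hu : Integrable (fun z ↦ f (u, z)) (κ u)) (hv : Integrable (fun z ↦ f (v, z)) (κ v)) :
    Integrable f (bernoulliMeasure u v q ⊗ₘ κ) := by
  rw [bernoulliMeasure_compProd, integrable_add_measure]
  exact ⟨((integrable_map_measure hf.aestronglyMeasurable (by fun_prop)).2 hu).smul_measure_nnreal,
    ((integrable_map_measure hf.aestronglyMeasurable (by fun_prop)).2 hv).smul_measure_nnreal⟩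

lemma memLp_two_bernoulliMeasure_compProd (hf : StronglyMeasurable f)
    (hu : MemLp (fun z ↦ f (u, z)) 2 (κ u)) (hv : MemLp (fun z ↦ f (v, z)) 2 (κ v)) :
    MemLp f 2 (bernoulliMeasure u v q ⊗ₘ κ) :=
  (memLp_two_iff_integrable_sq_norm hf.aestronglyMeasurable).2
    (integrable_bernoulliMeasure_compProd (hf.norm.pow 2)
      ((memLp_two_iff_integrable_sq_norm hu.1).1 hu) ((memLp_two_iff_integrable_sq_norm hv.1).1 hv))

lemma integral_bernoulliMeasure_compProd [NormedSpace ℝ G] (hf : StronglyMeasurable f)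
    (hu : Integrable (fun z ↦ f (u, z)) (κ u)) (hv : Integrable (fun z ↦ f (v, z)) (κ v)) :
    ∫ x, f x ∂(bernoulliMeasure u v q ⊗ₘ κ) =
      (q : ℝ) • ∫ z, f (u, z) ∂κ u + (1 - q : ℝ) • ∫ z, f (v, z) ∂κ v := by
  have h := integrable_bernoulliMeasure_compProd (q := q) hf hu hv
  rw [bernoulliMeasure_compProd, integrable_add_measure] at h
  rw [bernoulliMeasure_compProd, integral_add_measure h.1 h.2, integral_smul_nnreal_measure,
    integral_smul_nnreal_measure, integral_map (by fun_prop) hf.aestronglyMeasurable,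
    integral_map (by fun_prop) hf.aestronglyMeasurable]
  rfl

lemma variance_bernoulliMeasure_compProd {f : α × β → ℝ} (hf : StronglyMeasurable f)
    (hu : MemLp (fun z ↦ f (u, z)) 2 (κ u)) (hv : MemLp (fun z ↦ f (v, z)) 2 (κ v))
    (hu₀ : ∫ z, f (u, z) ∂κ u = 0) (hv₀ : ∫ z, f (v, z) ∂κ v = 0) :
    Var[f; bernoulliMeasure u v q ⊗ₘ κ] =
      q * ∫ z, f (u, z) ^ 2 ∂κ u + (1 - q) * ∫ z, f (v, z) ^ 2 ∂κ v := by
  have hmean : ∫ x, f x ∂(bernoulliMeasure u v q ⊗ₘ κ) = 0 := by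
    rw [integral_bernoulliMeasure_compProd hf (hu.integrable one_le_two)
      (hv.integrable one_le_two), hu₀, hv₀, smul_zero, smul_zero, add_zero]
  rw [variance_of_integral_eq_zero hf.aestronglyMeasurable.aemeasurable hmean]
  exact integral_bernoulliMeasure_compProd (hf.pow 2) hu.integrable_sq hv.integrable_sq

end BernoulliCompProd

section GaussianMoments

variable {ι : Type*} [Fintype ι] [DecidableEq ι]
  {μ : EuclideanSpace ℝ ι} {S : Matrix ι ι ℝ} {s t : EuclideanSpace ℝ ι}

lemma memLp_inner_multivariateGaussian (s : EuclideanSpace ℝ ι) :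
    MemLp (fun x ↦ ⟪s, x⟫) 2 (multivariateGaussian μ S) :=
  IsGaussian.memLp_two_id.const_inner s

lemma integral_inner_multivariateGaussian (s : EuclideanSpace ℝ ι) :
    ∫ x, ⟪s, x⟫ ∂multivariateGaussian μ S = ⟪s, μ⟫ := by
  rw [integral_inner IsGaussian.integrable_fun_id, integral_id_multivariateGaussian]

lemma covariance_inner_multivariateGaussian (hS : S.PosSemidef) :
    cov[fun x ↦ ⟪s, x⟫, fun x ↦ ⟪t, x⟫; multivariateGaussian μ S] =
      ⟪s, toEuclideanCLM (𝕜 := ℝ) S t⟫ := by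
  rw [← covarianceBilin_apply_eq_cov IsGaussian.memLp_two_id,
    covarianceBilin_multivariateGaussian hS, inner_toEuclideanCLM]

lemma memLp_rankOne_multivariateGaussian :
    MemLp (fun x ↦ rankOne ℝ x x) 2 (multivariateGaussian μ S) := by
  refine (memLp_two_iff_integrable_sq_norm measurable_rankOne_self.aestronglyMeasurable).2 ?_
  have h := (IsGaussian.memLp_id (multivariateGaussian μ S) 4 (by simp)).integrable_norm_pow
    (p := 4) (by norm_num)
  refine h.congr (.of_forall fun x ↦ ?_)
  simp only [id_eq, norm_rankOne]
  ring

lemma integral_rankOne_multivariateGaussian (hS : S.PosSemidef) :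
    ∫ x, rankOne ℝ x x ∂multivariateGaussian μ S =
      rankOne ℝ μ μ + toEuclideanCLM (𝕜 := ℝ) S := by
  have hint := (memLp_rankOne_multivariateGaussian (μ := μ) (S := S)).integrable (by norm_num)
  ext1 t
  refine ext_inner_left ℝ fun s ↦ ?_
  have hcov := covariance_inner_multivariateGaussian (μ := μ) (s := s) (t := t) hS
  rw [covariance_eq_sub (memLp_inner_multivariateGaussian s) (memLp_inner_multivariateGaussian t),
    integral_inner_multivariateGaussian, integral_inner_multivariateGaussian, sub_eq_iff_eq_add]
    at hcov
  rw [ContinuousLinearMap.integral_apply hint, ← integral_inner (hint.apply_continuousLinearMap t)]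
  simpa only [rankOne_apply, inner_smul_right, _root_.add_apply, inner_add_right,
    real_inner_comm t, Pi.mul_apply, mul_comm, add_comm] using hcov

lemma indepFun_inner_multivariateGaussian (hS : S.PosSemidef)
    (hst : ⟪s, toEuclideanCLM (𝕜 := ℝ) S t⟫ = 0) :
    IndepFun (fun x ↦ ⟪s, x⟫) (fun x ↦ ⟪t, x⟫) (multivariateGaussian μ S) :=
  HasGaussianLaw.indepFun_of_covariance_eq_zero
    (IsGaussian.hasGaussianLaw_id.map_fun ((innerSL ℝ s).prod (innerSL ℝ t)))
    ((covariance_inner_multivariateGaussian hS).trans hst)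

lemma integral_inner_sub_multivariateGaussian (s : EuclideanSpace ℝ ι) :
    ∫ x, ⟪s, x - μ⟫ ∂multivariateGaussian μ S = 0 := by
  have hint : Integrable (fun x ↦ x - μ) (multivariateGaussian μ S) :=
    IsGaussian.integrable_fun_id.sub (integrable_const μ)
  rw [integral_inner hint, integral_sub IsGaussian.integrable_fun_id (integrable_const μ),
    integral_id_multivariateGaussian]
  simp

lemma integral_sq_sub_inner_sub_multivariateGaussian (hS : S.PosSemidef) (c : ℝ) :
    ∫ x, (c - ⟪t, x - μ⟫) ^ 2 ∂multivariateGaussian μ S =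
      c ^ 2 + ⟪t, toEuclideanCLM (𝕜 := ℝ) S t⟫ := by
  have hmem : MemLp (fun x ↦ ⟪t, x - μ⟫) 2 (multivariateGaussian μ S) :=
    (IsGaussian.memLp_two_id.sub (memLp_const μ)).const_inner t
  have hmem' : MemLp (fun x ↦ c - ⟪t, x - μ⟫) 2 (multivariateGaussian μ S) :=
    (memLp_const c).sub hmem
  have hvar : Var[fun x ↦ c - ⟪t, x - μ⟫; multivariateGaussian μ S] =
      ⟪t, toEuclideanCLM (𝕜 := ℝ) S t⟫ := by
    rw [variance_const_sub hmem.1]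
    simp_rw [inner_sub_right]
    rw [variance_sub_const (memLp_inner_multivariateGaussian t).1,
      ← covariance_self (by fun_prop), covariance_inner_multivariateGaussian hS]
  have hmean : ∫ x, (c - ⟪t, x - μ⟫) ∂multivariateGaussian μ S = c := by
    rw [integral_sub (integrable_const c) (hmem.integrable (by norm_num)),
      integral_inner_sub_multivariateGaussian]
    simp
  rw [variance_eq_sub hmem', hmean, sub_eq_iff_eq_add'] at hvar
  exact hvar

lemma indepFun_sub_inner_sub_multivariateGaussian (hS : S.PosSemidef)
    (hst : ⟪s, toEuclideanCLM (𝕜 := ℝ) S t⟫ = 0) (c : ℝ) :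
    IndepFun (fun x ↦ ⟪s, x - μ⟫) (fun x ↦ c - ⟪t, x - μ⟫) (multivariateGaussian μ S) := by
  have h := (indepFun_inner_multivariateGaussian (μ := μ) hS hst).comp
    (φ := fun r ↦ r - ⟪s, μ⟫) (ψ := fun r ↦ c - (r - ⟪t, μ⟫)) (by fun_prop) (by fun_prop)
  simpa only [Function.comp_def, ← inner_sub_right] using h

lemma integral_inner_mul_sub_inner_multivariateGaussian (hS : S.PosSemidef)
    (hst : ⟪s, toEuclideanCLM (𝕜 := ℝ) S t⟫ = 0) (c : ℝ) :
    ∫ x, ⟪s, x - μ⟫ * (c - ⟪t, x - μ⟫) ∂multivariateGaussian μ S = 0 := by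
  rw [(indepFun_sub_inner_sub_multivariateGaussian hS hst c).integral_fun_mul_eq_mul_integral
    (by fun_prop) (by fun_prop), integral_inner_sub_multivariateGaussian, zero_mul]

lemma integral_sq_inner_mul_sub_inner_multivariateGaussian (hS : S.PosSemidef)
    (hst : ⟪s, toEuclideanCLM (𝕜 := ℝ) S t⟫ = 0) (c : ℝ) :
    ∫ x, (⟪s, x - μ⟫ * (c - ⟪t, x - μ⟫)) ^ 2 ∂multivariateGaussian μ S =
      ⟪s, toEuclideanCLM (𝕜 := ℝ) S s⟫ * (c ^ 2 + ⟪t, toEuclideanCLM (𝕜 := ℝ) S t⟫) := by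
  have hindep := (indepFun_sub_inner_sub_multivariateGaussian (μ := μ) hS hst c).comp
    (φ := (· ^ 2)) (ψ := (· ^ 2)) (by fun_prop) (by fun_prop)
  have hs := integral_sq_sub_inner_sub_multivariateGaussian (μ := μ) (t := s) hS 0
  simp only [zero_sub, neg_sq, zero_pow two_ne_zero, zero_add] at hs
  simp only [mul_pow]
  rw [← integral_sq_sub_inner_sub_multivariateGaussian (μ := μ) (t := t) hS c, ← hs]
  exact hindep.integral_fun_mul_eq_mul_integral (by fun_prop) (by fun_prop)

end GaussianMoments

section ObservationMoments

variable {ι : Type*} [Fintype ι] [DecidableEq ι] {μ : EuclideanSpace ℝ ι} {S : Matrix ι ι ℝ}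

lemma memLp_observationMoments (y : ℝ) :
    MemLp (fun x ↦ observationMoments x y) 2 (multivariateGaussian μ S) := by
  have hid : MemLp (fun x : EuclideanSpace ℝ ι ↦ x) 2 (multivariateGaussian μ S) :=
    IsGaussian.memLp_two_id
  exact .of_fst_snd ⟨.of_fst_snd ⟨memLp_const _, hid.const_smul y⟩,
    .of_fst_snd ⟨.of_fst_snd ⟨memLp_const _, hid.const_smul (1 - y)⟩,
      memLp_rankOne_multivariateGaussian⟩⟩

lemma integral_observationMoments (hS : S.PosSemidef) (y : ℝ) :
    ∫ x, observationMoments x y ∂multivariateGaussian μ S =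
      observationMoments μ y + (0, 0, toEuclideanCLM (𝕜 := ℝ) S) := by
  have hid : Integrable (fun x ↦ x) (multivariateGaussian μ S) := IsGaussian.integrable_fun_id
  have hgroup (c : ℝ) :
      ∫ x, (c, c • x) ∂multivariateGaussian μ S = (c, c • μ) := by
    rw [integral_pair (integrable_const c) (hid.fun_smul c), integral_smul,
      integral_id_multivariateGaussian]
    simp
  have hgroupint (c : ℝ) : Integrable (fun x ↦ (c, c • x)) (multivariateGaussian μ S) :=
    (integrable_const c).prodMk (hid.fun_smul c)
  have hrank := (memLp_rankOne_multivariateGaussian (μ := μ) (S := S)).integrable one_le_two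
  simp only [observationMoments]
  rw [integral_pair (hgroupint y) ((hgroupint (1 - y)).prodMk hrank),
    integral_pair (hgroupint (1 - y)) hrank, hgroup, hgroup,
    integral_rankOne_multivariateGaussian hS]
  simp

end ObservationMoments

section ObservationLaw

variable {p : ℕ} {μ₁ μ₂ : EuclideanSpace ℝ (Fin p)} {S : Matrix (Fin p) (Fin p) ℝ}
  {q : unitInterval}

lemma classKernel_one : classKernel μ₁ μ₂ S 1 = multivariateGaussian μ₁ S := by
  change multivariateGaussian _ S = _
  simp

lemma classKernel_zero : classKernel μ₁ μ₂ S 0 = multivariateGaussian μ₂ S := by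
  change multivariateGaussian _ S = _
  simp

/-- The joint law of the label and the observation. -/
noncomputable abbrev observationLaw (q : unitInterval) (μ₁ μ₂ : EuclideanSpace ℝ (Fin p))
    (S : Matrix (Fin p) (Fin p) ℝ) : Measure (ℝ × EuclideanSpace ℝ (Fin p)) :=
  bernoulliMeasure 1 0 q ⊗ₘ classKernel μ₁ μ₂ S

lemma memLp_observationMoments_observationLaw :
    MemLp (fun u ↦ observationMoments u.2 u.1) 2 (observationLaw q μ₁ μ₂ S) :=
  memLp_two_bernoulliMeasure_compProd measurable_observationMoments.stronglyMeasurable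
    (memLp_observationMoments 1) (memLp_observationMoments 0)

lemma integral_observationMoments_observationLaw (hS : S.PosSemidef) :
    ∫ u, observationMoments u.2 u.1 ∂observationLaw q μ₁ μ₂ S =
      populationMoments q (1 - q) μ₁ μ₂ (toEuclideanCLM (𝕜 := ℝ) S) := by
  rw [integral_bernoulliMeasure_compProd measurable_observationMoments.stronglyMeasurable
      ((memLp_observationMoments (ι := Fin p) 1).integrable one_le_two)
      ((memLp_observationMoments (ι := Fin p) 0).integrable one_le_two),
    classKernel_one, classKernel_zero, integral_observationMoments hS,
    integral_observationMoments hS]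
  simp only [observationMoments, populationMoments, one_smul, sub_self, zero_smul, sub_zero,
    Prod.mk_add_mk, Prod.smul_mk, smul_eq_mul, mul_one, mul_zero, smul_zero, smul_add, add_zero,
    zero_add, Prod.mk.injEq, true_and]
  module

end ObservationLaw

section Covariance

variable {p : ℕ} {μ₁ μ₂ : EuclideanSpace ℝ (Fin p)} {S : Matrix (Fin p) (Fin p) ℝ}
  {q : unitInterval}

lemma toEuclideanCLM_discriminant (hS : S.PosDef) :
    toEuclideanCLM (𝕜 := ℝ) S (discriminant μ₁ μ₂ S) = μ₂ - μ₁ := by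
  rw [discriminant, mulVecE_inv, ← mul_apply_eq_comp,
    Ring.mul_inverse_cancel _ (isUnit_toEuclideanCLM hS), one_apply_eq_self]

lemma direction_populationMoments_toEuclideanCLM {a b : ℝ} (ha : a ≠ 0) (hb : b ≠ 0) :
    direction (populationMoments a b μ₁ μ₂ (toEuclideanCLM (𝕜 := ℝ) S)) = discriminant μ₁ μ₂ S := by
  rw [direction_populationMoments ha hb, discriminant, mulVecE_inv]

lemma discriminant_ne_zero (hS : S.PosDef) (hμ : μ₁ ≠ μ₂) : discriminant μ₁ μ₂ S ≠ 0 := by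
  intro h
  have := toEuclideanCLM_discriminant (μ₁ := μ₁) (μ₂ := μ₂) hS
  rw [h, map_zero] at this
  exact hμ (sub_eq_zero.1 this.symm).symm

lemma inner_toEuclideanCLM_discriminant (hS : S.PosDef) :
    ⟪discriminant μ₁ μ₂ S, toEuclideanCLM (𝕜 := ℝ) S (discriminant μ₁ μ₂ S)⟫ =
      mahalanobisSq μ₁ μ₂ S := by
  rw [toEuclideanCLM_discriminant hS, real_inner_comm, mahalanobisSq, ← inner_toEuclideanCLM]
  rfl

lemma inner_fderiv_direction_observationMoments_one {a b : ℝ} (ha : a ≠ 0) (hb : b ≠ 0)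
    (hS : S.PosDef) (s x : EuclideanSpace ℝ (Fin p)) :
    ⟪s, fderiv ℝ direction (populationMoments a b μ₁ μ₂ (toEuclideanCLM (𝕜 := ℝ) S))
        (observationMoments x 1)⟫ =
      ⟪toEuclideanCLM (𝕜 := ℝ) S⁻¹ s, x - μ₁⟫ * (-a⁻¹ - ⟪discriminant μ₁ μ₂ S, x - μ₁⟫) := by
  rw [fderiv_direction_observationMoments_one ha hb (isUnit_toEuclideanCLM hS),
    ← toEuclideanCLM_inv, inner_toEuclideanCLM_comm hS.isHermitian.inv, inner_smul_right, neg_add',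
    mul_comm]
  rfl

lemma inner_fderiv_direction_observationMoments_zero {a b : ℝ} (ha : a ≠ 0) (hb : b ≠ 0)
    (hS : S.PosDef) (s x : EuclideanSpace ℝ (Fin p)) :
    ⟪s, fderiv ℝ direction (populationMoments a b μ₁ μ₂ (toEuclideanCLM (𝕜 := ℝ) S))
        (observationMoments x 0)⟫ =
      ⟪toEuclideanCLM (𝕜 := ℝ) S⁻¹ s, x - μ₂⟫ * (b⁻¹ - ⟪discriminant μ₁ μ₂ S, x - μ₂⟫) := by
  rw [fderiv_direction_observationMoments_zero ha hb (isUnit_toEuclideanCLM hS),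
    ← toEuclideanCLM_inv, inner_toEuclideanCLM_comm hS.isHermitian.inv, inner_smul_right, mul_comm]
  rfl

lemma variance_inner_fderiv_direction (hq₀ : (q : ℝ) ≠ 0) (hq₁ : (1 - q : ℝ) ≠ 0) (hS : S.PosDef)
    {s : EuclideanSpace ℝ (Fin p)} (hs : ⟪s, discriminant μ₁ μ₂ S⟫ = 0) :
    Var[fun u ↦ ⟪s, fderiv ℝ direction
          (populationMoments q (1 - q) μ₁ μ₂ (toEuclideanCLM (𝕜 := ℝ) S))
          (observationMoments u.2 u.1)⟫; observationLaw q μ₁ μ₂ S] =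
      ((q * (1 - q) : ℝ)⁻¹ + mahalanobisSq μ₁ μ₂ S) * ⟪s, toEuclideanCLM (𝕜 := ℝ) S⁻¹ s⟫ := by
  set L := fderiv ℝ direction (populationMoments q (1 - q) μ₁ μ₂ (toEuclideanCLM (𝕜 := ℝ) S))
  set r := toEuclideanCLM (𝕜 := ℝ) S⁻¹ s with hr
  have hSr : toEuclideanCLM (𝕜 := ℝ) S r = s := by
    rw [hr, toEuclideanCLM_inv, ← mul_apply_eq_comp,
      Ring.mul_inverse_cancel _ (isUnit_toEuclideanCLM hS), one_apply_eq_self]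
  have horth : ⟪r, toEuclideanCLM (𝕜 := ℝ) S (discriminant μ₁ μ₂ S)⟫ = 0 := by
    rw [inner_toEuclideanCLM_comm hS.isHermitian, hSr, hs]
  have hmemLp {μ : EuclideanSpace ℝ (Fin p)} (y : ℝ) :
      MemLp (fun x ↦ ⟪s, L (observationMoments x y)⟫) 2 (multivariateGaussian μ S) :=
    (L.comp_memLp' (memLp_observationMoments y)).const_inner s
  have hmeas : StronglyMeasurable fun u : ℝ × EuclideanSpace ℝ (Fin p) ↦
      ⟪s, L (observationMoments u.2 u.1)⟫ := by
    have := measurable_observationMoments (F := EuclideanSpace ℝ (Fin p))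
    fun_prop
  rw [variance_bernoulliMeasure_compProd hmeas (hmemLp 1) (hmemLp 0)]
  · simp only [classKernel_one, classKernel_zero, L,
      inner_fderiv_direction_observationMoments_one hq₀ hq₁ hS,
      inner_fderiv_direction_observationMoments_zero hq₀ hq₁ hS, ← hr,
      integral_sq_inner_mul_sub_inner_multivariateGaussian hS.posSemidef horth,
      inner_toEuclideanCLM_discriminant hS, hSr, real_inner_comm s r]
    field_simp
    ring
  · simp only [classKernel_one, L, inner_fderiv_direction_observationMoments_one hq₀ hq₁ hS,
      ← hr, integral_inner_mul_sub_inner_multivariateGaussian hS.posSemidef horth]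
  · simp only [classKernel_zero, L, inner_fderiv_direction_observationMoments_zero hq₀ hq₁ hS,
      ← hr, integral_inner_mul_sub_inner_multivariateGaussian hS.posSemidef horth]

lemma unitDirection_populationMoments {a b : ℝ} (ha : a ≠ 0) (hb : b ≠ 0) :
    unitDirection (populationMoments a b μ₁ μ₂ (toEuclideanCLM (𝕜 := ℝ) S)) =
      unit (discriminant μ₁ μ₂ S) := by
  rw [unitDirection, direction_populationMoments_toEuclideanCLM ha hb]
  rfl

lemma toEuclideanCLM_projCompl (v : EuclideanSpace ℝ (Fin p)) :
    toEuclideanCLM (𝕜 := ℝ) (projCompl v) = 1 - (‖v‖ ^ 2)⁻¹ • rankOne ℝ v v := by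
  rw [projCompl, map_sub, map_one, map_smul, toEuclideanCLM_outer]

lemma isHermitian_projCompl (v : EuclideanSpace ℝ (Fin p)) : (projCompl v).IsHermitian := by
  simp [Matrix.IsHermitian, projCompl, outer, transpose_vecMulVec,
    conjTranspose_eq_transpose_of_trivial]

lemma hasFDerivAt_unitDirection_populationMoments {a b : ℝ} (ha : a ≠ 0) (hb : b ≠ 0)
    (hS : S.PosDef) (hμ : μ₁ ≠ μ₂) :
    HasFDerivAt unitDirection
      ((‖discriminant μ₁ μ₂ S‖⁻¹ • toEuclideanCLM (𝕜 := ℝ) (projCompl (discriminant μ₁ μ₂ S))) ∘L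
        fderiv ℝ direction (populationMoments a b μ₁ μ₂ (toEuclideanCLM (𝕜 := ℝ) S)))
      (populationMoments a b μ₁ μ₂ (toEuclideanCLM (𝕜 := ℝ) S)) := by
  have hdir : direction (populationMoments a b μ₁ μ₂ (toEuclideanCLM (𝕜 := ℝ) S)) =
      discriminant μ₁ μ₂ S := direction_populationMoments_toEuclideanCLM ha hb
  rw [toEuclideanCLM_projCompl, ← hdir]
  refine hasFDerivAt_unitDirection ha hb ?_ (hdir ▸ discriminant_ne_zero hS hμ)
  rw [withinScatter_populationMoments ha hb]
  exact isUnit_toEuclideanCLM hS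

lemma inner_toEuclideanCLM_projCompl_self (t v : EuclideanSpace ℝ (Fin p)) :
    ⟪toEuclideanCLM (𝕜 := ℝ) (projCompl v) t, v⟫ = 0 := by
  rw [← inner_toEuclideanCLM_comm (isHermitian_projCompl v), toEuclideanCLM_projCompl]
  obtain rfl | hv := eq_or_ne v 0
  · simp
  · simp [hv]

lemma posSemidef_limitCov (hS : S.PosDef) {a : ℝ} (ha₀ : 0 < a) (ha₁ : a < 1) :
    (limitCov a μ₁ μ₂ S).PosSemidef := by
  have : 0 < 1 - a := sub_pos.2 ha₁
  have hτ : 0 ≤ mahalanobisSq μ₁ μ₂ S := by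
    have := hS.inv.posSemidef.dotProduct_mulVec_nonneg (μ₂ - μ₁).ofLp
    rwa [star_trivial] at this
  have hsandwich := hS.inv.posSemidef.mul_mul_conjTranspose_same (projCompl (discriminant μ₁ μ₂ S))
  rw [(isHermitian_projCompl _).eq] at hsandwich
  exact hsandwich.smul (by positivity)

lemma variance_inner_fderiv_unitDirection (hq₀ : (q : ℝ) ≠ 0) (hq₁ : (1 - q : ℝ) ≠ 0)
    (hS : S.PosDef) (hμ : μ₁ ≠ μ₂) (t : EuclideanSpace ℝ (Fin p)) :
    Var[fun u ↦ ⟪t, fderiv ℝ unitDirection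
          (populationMoments q (1 - q) μ₁ μ₂ (toEuclideanCLM (𝕜 := ℝ) S))
          (observationMoments u.2 u.1)⟫; observationLaw q μ₁ μ₂ S] =
      t.ofLp ⬝ᵥ limitCov q μ₁ μ₂ S *ᵥ t.ofLp := by
  have hproj := inner_toEuclideanCLM_comm (isHermitian_projCompl (discriminant μ₁ μ₂ S)) t
  simp only [(hasFDerivAt_unitDirection_populationMoments hq₀ hq₁ hS hμ).fderiv,
    ContinuousLinearMap.comp_apply,
    _root_.smul_apply, inner_smul_right, hproj]
  rw [variance_const_mul,
    variance_inner_fderiv_direction hq₀ hq₁ hS (inner_toEuclideanCLM_projCompl_self t _),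
    ← inner_toEuclideanCLM, limitCov, map_smul, map_mul, map_mul, _root_.smul_apply,
    inner_smul_right, mul_apply_eq_comp, mul_apply_eq_comp, hproj]
  field_simp

end Covariance

section Sample

variable {Ω : Type*} [MeasurableSpace Ω] {P : Measure Ω}
  {p : ℕ} {α₁ : unitInterval} {μ₁ μ₂ : EuclideanSpace ℝ (Fin p)} {S : Matrix (Fin p) (Fin p) ℝ}
  {X : ℕ → Ω → EuclideanSpace ℝ (Fin p)} {Y : ℕ → Ω → ℝ}

lemma IsSample.hasLaw (h : IsSample P α₁ μ₁ μ₂ S X Y) (i : ℕ) :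
    HasLaw (fun ω ↦ (Y i ω, X i ω)) (observationLaw α₁ μ₁ μ₂ S) P :=
  (h.label i).prodMk_of_hasCondDistrib (h.cond i)

lemma IsSample.iIndepFun_observationMoments (h : IsSample P α₁ μ₁ μ₂ S X Y) :
    iIndepFun (fun i ω ↦ observationMoments (X i ω) (Y i ω)) P :=
  h.indep.comp (fun _ u ↦ observationMoments u.1 u.2)
    fun _ ↦ measurable_observationMoments.comp measurable_swap

lemma IsSample.identDistrib_observationMoments (h : IsSample P α₁ μ₁ μ₂ S X Y) (i : ℕ) :
    IdentDistrib (fun ω ↦ observationMoments (X i ω) (Y i ω))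
      (fun ω ↦ observationMoments (X 0 ω) (Y 0 ω)) P P :=
  ((h.hasLaw i).identDistrib (h.hasLaw 0)).comp measurable_observationMoments

lemma IsSample.memLp_observationMoments (h : IsSample P α₁ μ₁ μ₂ S X Y) (i : ℕ) :
    MemLp (fun ω ↦ observationMoments (X i ω) (Y i ω)) 2 P :=
  ((h.hasLaw i).map_eq ▸ memLp_observationMoments_observationLaw).comp_of_map
    (h.hasLaw i).aemeasurable

lemma IsSample.integral_observationMoments (h : IsSample P α₁ μ₁ μ₂ S X Y)
    (hS : S.PosSemidef) (i : ℕ) :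
    ∫ ω, observationMoments (X i ω) (Y i ω) ∂P =
      populationMoments α₁ (1 - α₁) μ₁ μ₂ (toEuclideanCLM (𝕜 := ℝ) S) :=
  ((h.hasLaw i).integral_comp memLp_observationMoments_observationLaw.1).trans
    (integral_observationMoments_observationLaw hS)

lemma IsSample.variance_inner_fderiv_unitDirection (h : IsSample P α₁ μ₁ μ₂ S X Y)
    (hα₀ : (α₁ : ℝ) ≠ 0) (hα₁ : (1 - α₁ : ℝ) ≠ 0) (hS : S.PosDef) (hμ : μ₁ ≠ μ₂) (i : ℕ)
    (t : EuclideanSpace ℝ (Fin p)) :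
    Var[fun ω ↦ ⟪t, fderiv ℝ unitDirection
          (populationMoments α₁ (1 - α₁) μ₁ μ₂ (toEuclideanCLM (𝕜 := ℝ) S))
          (observationMoments (X i ω) (Y i ω))⟫; P] =
      t.ofLp ⬝ᵥ limitCov α₁ μ₁ μ₂ S *ᵥ t.ofLp := by
  rw [← LDA.variance_inner_fderiv_unitDirection hα₀ hα₁ hS hμ]
  generalize fderiv ℝ unitDirection
    (populationMoments α₁ (1 - α₁) μ₁ μ₂ (toEuclideanCLM (𝕜 := ℝ) S)) = L
  have hmeas : Measurable fun u : ℝ × EuclideanSpace ℝ (Fin p) ↦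
      ⟪t, L (observationMoments u.2 u.1)⟫ := by
    have := measurable_observationMoments (F := EuclideanSpace ℝ (Fin p))
    fun_prop
  rw [← (h.hasLaw i).map_eq, variance_map hmeas.aemeasurable (h.hasLaw i).aemeasurable]
  rfl

lemma IsSample.aemeasurable_unit_ldaEstimator (h : IsSample P α₁ μ₁ μ₂ S X Y) (n : ℕ) :
    AEMeasurable (fun ω ↦ unit (ldaEstimator n (fun i ↦ X i ω) (fun i ↦ Y i ω))) P := by
  have hmoments (i : ℕ) := (h.identDistrib_observationMoments i).aemeasurable_fst
  have hsum : AEMeasurable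
      (fun ω ↦ ∑ i ∈ Finset.range n, observationMoments (X i ω) (Y i ω)) P := by fun_prop
  have hdirection := measurable_direction.comp_aemeasurable hsum
  simp only [ldaEstimator_eq_smul_direction, unit]
  fun_prop

end Sample

end LDA

theorem theorem1 {Ω : Type*} [MeasurableSpace Ω] (P : Measure Ω) [IsProbabilityMeasure P]
    {p : ℕ} (α₁ : unitInterval) (hα₀ : 0 < α₁) (hα₁ : α₁ < 1)
    (μ₁ μ₂ : EuclideanSpace ℝ (Fin p)) (hμ : μ₁ ≠ μ₂)
    (S : Matrix (Fin p) (Fin p) ℝ) (hS : S.PosDef)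
    (X : ℕ → Ω → EuclideanSpace ℝ (Fin p)) (Y : ℕ → Ω → ℝ)
    (hXY : LDA.IsSample P α₁ μ₁ μ₂ S X Y) :
    TendstoInDistribution
      (fun (n : ℕ) ω ↦ √(n : ℝ) •
        (LDA.unit (LDA.ldaEstimator n (fun i ↦ X i ω) (fun i ↦ Y i ω)) -
          LDA.unit (LDA.discriminant μ₁ μ₂ S)))
      atTop id (fun _ ↦ P) (multivariateGaussian 0 (LDA.limitCov (α₁ : ℝ) μ₁ μ₂ S)) := by
  have hα₀' : (α₁ : ℝ) ≠ 0 := (unitInterval.coe_pos.2 hα₀).ne'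
  have hα₁' : (1 - α₁ : ℝ) ≠ 0 := (sub_pos.2 (unitInterval.coe_lt_one.2 hα₁)).ne'
  have hmean := hXY.integral_observationMoments hS.posSemidef 0
  have hdiff :=
    (LDA.hasFDerivAt_unitDirection_populationMoments hα₀' hα₁' hS hμ).differentiableAt
  have hclt := LDA.tendstoInDistribution_sqrt_smul_comp_average_sub
    (hXY.memLp_observationMoments 0) hXY.iIndepFun_observationMoments
    hXY.identDistrib_observationMoments LDA.measurable_unitDirection (hmean ▸ hdiff.hasFDerivAt)
    (LDA.posSemidef_limitCov hS hα₀ hα₁)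
    (hXY.variance_inner_fderiv_unitDirection hα₀' hα₁' hS hμ 0)
  refine LDA.tendstoInDistribution_of_eventuallyEq hclt (fun n ↦ ?_) ?_
  · exact ((hXY.aemeasurable_unit_ldaEstimator n).sub_const _).const_smul √(n : ℝ)
  · filter_upwards [eventually_gt_atTop 2] with n hn
    simp only [hmean, LDA.unitDirection_populationMoments hα₀' hα₁', LDA.unit_ldaEstimator _ _ hn]
    rfl
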